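/- Let $\mathbb{F}_q$ be a finite field with $q$ elements and let $f(x)=a_0+a_1x+\dots+a_{d-1}x^{d-1}+x^d\in\mathbb{F}_q[x]$ be a monic irreducible polynomial of degree $d$ (the case $f=x$ is allowed). Let $c(f)$ be the companion matrix of $f$: the $d\times d$ matrix with ones on the superdiagonal, last row $(-a_0,-a_1,\dots,-a_{d-1})$, and zeros elsewhere. For $m\ge 1$ let $J_m(f)$ be the $m\times m$ block matrix, with blocks of size $d\times d$, that has $c(f)$ in each diagonal block, the identity matrix in each superdiagonal block, and zeros elsewhere. For a partition $\lambda=(\lambda_1\ge\lambda_2\ge\dots\ge\lambda_k\ge 1)$ of a non-negative integer $n$ put $J_\lambda(f)=J_{\lambda_1}(f)\oplus\dots\oplus J_{\lambda_k}(f)$, a matrix of order $dn$. Let $l(\lambda)=k$ be the number of parts of $\lambda$, let $\lambda'_i$ be the number of parts of $\lambda$ that are at least $i$, and let $\langle\lambda,\lambda\rangle=\sum_{i\ge1}(\lambda'_i)^2$. Then the number of nilpotent matrices of order $dn$ over $\mathbb{F}_q$ that commute with $J_\lambda(f)$ is $$q^{\,d(\langle\lambda,\lambda\rangle-l(\lambda))}.$$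 -/

import Mathlib

namespace BuildingBlock

open Polynomial

/-- The companion matrix of `f = a₀ + a₁ x + ⋯ + x ^ d`: ones on the superdiagonal and last row
`-a₀, -a₁, …, -a_{d-1}`. -/
def companion {F : Type*} [Field F] (f : F[X]) :
    Matrix (Fin f.natDegree) (Fin f.natDegree) F :=
  Matrix.of fun i j =>
    if (i : ℕ) + 1 = f.natDegree then -f.coeff j
    else if (i : ℕ) + 1 = j then 1 else 0

/-- The Jordan block matrix of order `m`: an `m × m` array of blocks of size `deg f`, with the
companion matrix of `f` on the diagonal and the identity on the superdiagonal, flattened to a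
matrix of scalars. -/
def jordanBlock {F : Type*} [Field F] (f : F[X]) (m : ℕ) :
    Matrix (Fin m × Fin f.natDegree) (Fin m × Fin f.natDegree) F :=
  Matrix.comp _ _ _ _ F <| Matrix.of fun a b : Fin m =>
    if a = b then companion f
    else if (a : ℕ) + 1 = b then 1 else 0

/-- The parts `λ₁ ≥ λ₂ ≥ ⋯ ≥ λ_k` of a partition, in weakly decreasing order. -/
def partList {n : ℕ} (p : n.Partition) : List ℕ :=
  p.parts.sort (· ≥ ·)

/-- The length `l(λ)`: the number of parts. -/
def length {n : ℕ} (p : n.Partition) : ℕ :=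
  p.parts.card

/-- The rows (and columns) of `J_λ(f)`: a part `λ_s`, a block row inside `J_{λ_s}(f)`, and a
row inside that block row. -/
abbrev Idx {F : Type*} [Field F] {n : ℕ} (p : n.Partition) (f : F[X]) : Type :=
  Σ s : Fin (partList p).length, Fin ((partList p).get s) × Fin f.natDegree

/-- `J_λ(f)`, the direct sum of the Jordan block matrices `J_{λ₁}(f), …, J_{λ_k}(f)`. -/
def jordanMatrix {F : Type*} [Field F] {n : ℕ} (p : n.Partition) (f : F[X]) :
    Matrix (Idx p f) (Idx p f) F :=
  Matrix.blockDiagonal' fun s => jordanBlock f ((partList p).get s)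

/-- The `i`-th part of the conjugate partition: the number of parts that are at least `i`. -/
def conjPart {n : ℕ} (p : n.Partition) (i : ℕ) : ℕ :=
  (p.parts.filter (i ≤ ·)).card

/-- The parts of the conjugate of a partition of `n` vanish beyond index `n`. -/
theorem conjPart_eq_zero {n : ℕ} (p : n.Partition) {i : ℕ} (hi : n < i) : conjPart p i = 0 := by
  rw [conjPart, Multiset.card_eq_zero, Multiset.filter_eq_nil]
  intro a ha h
  have := p.le_of_mem_parts ha
  omega

/-- The inner product `⟨λ, μ⟩ = ∑_{i ≥ 1} λ'_i μ'_i`. The terms with `i > m` are zero. -/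
def inner {m n : ℕ} (p : m.Partition) (r : n.Partition) : ℕ :=
  ∑ i ∈ Finset.Icc 1 m, conjPart p i * conjPart r i

/-- `l(λ) ≤ ⟨λ, λ⟩`, so the natural-number difference `⟨λ, λ⟩ - l(λ)` is the true one. -/
theorem length_le_inner {n : ℕ} (p : n.Partition) : length p ≤ inner p p := by
  have h1 : conjPart p 1 = length p := by
    rw [conjPart, length, Multiset.filter_eq_self.2]
    intro a ha
    exact p.parts_pos ha
  rcases Nat.eq_zero_or_pos n with rfl | hn
  · have : length p = 0 := by
      rw [← h1]
      exact conjPart_eq_zero p Nat.one_pos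
    omega
  · calc length p ≤ length p * length p := Nat.le_mul_self _
      _ = conjPart p 1 * conjPart p 1 := by rw [h1]
      _ ≤ inner p p :=
        Finset.single_le_sum (f := fun i => conjPart p i * conjPart p i)
          (fun _ _ => Nat.zero_le _) (Finset.mem_Icc.2 ⟨le_rfl, hn⟩)

end BuildingBlock

/-!
Let `θ` be the class of `x` in `K = F[x] / (f)`, a finite field with `Q = q ^ d` elements. The
transpose of the companion matrix is the matrix of multiplication by `θ`, so the transpose of
`J_λ(f)` is the restriction of scalars of the matrix `θ + S` over `K`, where `S` is multiplication
by `t` on `V = ⨁ K[t] / (t ^ λ_s)` (`BuildingBlock.transpose_jordanMatrix_submatrix`). Since `S` is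
nilpotent, Frobenius makes `θ` a power of `θ + S`. A matrix over `F` commuting with `θ + S`
therefore commutes with `θ`, so it is `K`-linear, and with `S`
(`Matrix.natCard_isNilpotent_commute_restrictScalarsHom`). It remains to count the nilpotent
elements of `End_{K[t]} V`.

The blocks of an endomorphism of `V` are Hankel matrices after reversing the rows
(`Matrix.commuteShiftEquiv`), so there are `Q ^ ∑ min (λ_r, λ_s) = Q ^ ⟨λ, λ⟩` endomorphisms. An
endomorphism that vanishes on the socle `ker S` is nilpotent, and the action on the socle preserves
the filtration by powers of `t`. Hence an endomorphism is nilpotent if and only if it acts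
nilpotently on each graded piece of the socle. The resulting homomorphism
`Matrix.socleBlocks` to a product of matrix algebras is surjective, so it preserves the proportion
of nilpotent elements. By the Fine–Herstein theorem
(`Module.End.natCard_isNilpotent_mul_natCard`) this proportion is `1 / |W|` for `End W`, so in
total it is `Q ^ (-l(λ))`, the socle having dimension `l(λ)`.

The Fine–Herstein theorem for `V` of dimension `n ≥ 1` is proved by strong induction. For a proper
subspace `W`, the induction hypothesis gives as many nilpotent endomorphisms with image in `W` as
linear maps `K ^ (n - 1) → V` with image in `W`. Both kinds of map always have proper image, so by
inclusion–exclusion over the subspaces the totals agree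
(`Nat.card_eq_of_card_le_eq`), and there are `|V| ^ (n - 1)` maps of the second kind.
-/

/-! ### The Fine–Herstein theorem -/

theorem Nat.card_le_eq_card_eq_add_sum {α C : Type*} [PartialOrder α] [Fintype α] [Finite C]
    [DecidableLT α] (k : C → α) (w : α) :
    Nat.card {c // k c ≤ w} = Nat.card {c // k c = w} +
      ∑ v ∈ Finset.univ.filter (· < w), Nat.card {c // k c = v} := by
  classical
  have := Fintype.ofFinite C
  simp_rw [Nat.card_eq_fintype_card, Fintype.card_subtype]
  rw [Finset.card_eq_sum_card_fiberwise (f := k) (t := Finset.univ.filter (· ≤ w))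
    (fun c hc => by simpa using hc)]
  have : Finset.univ.filter (· ≤ w) = insert w (Finset.univ.filter (· < w)) := by
    ext v
    simp [le_iff_eq_or_lt]
  rw [this, Finset.sum_insert (by simp)]
  congr 1
  · congr 1
    ext c
    simp +contextual
  · refine Finset.sum_congr rfl fun v hv => ?_
    congr 1
    ext c
    simp only [Finset.mem_filter, Finset.mem_univ, true_and] at hv ⊢
    exact ⟨And.right, fun e => ⟨e ▸ hv.le, e⟩⟩

/-- Two finite sets mapping to a finite poset have the same cardinality if, over each element
`w` of a lower set containing both images, equally many elements are mapped below `w`. -/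
theorem Nat.card_eq_of_card_le_eq {α A B : Type*} [PartialOrder α] [Finite α] [Finite A]
    [Finite B] (f : A → α) (g : B → α) (P : α → Prop) (hP : ∀ v w, v ≤ w → P w → P v)
    (hf : ∀ a, P (f a)) (hg : ∀ b, P (g b))
    (h : ∀ w, P w → Nat.card {a // f a ≤ w} = Nat.card {b // g b ≤ w}) :
    Nat.card A = Nat.card B := by
  classical
  have := Fintype.ofFinite α
  have fib : ∀ w, P w → Nat.card {a // f a = w} = Nat.card {b // g b = w} := by
    intro w
    induction w using WellFoundedLT.induction with
    | _ w ih =>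
      intro hw
      have h1 := h w hw
      rw [Nat.card_le_eq_card_eq_add_sum f, Nat.card_le_eq_card_eq_add_sum g,
        Finset.sum_congr rfl fun v hv =>
        ih v (Finset.mem_filter.1 hv).2 (hP v w (Finset.mem_filter.1 hv).2.le hw)] at h1
      exact Nat.add_right_cancel h1
  rw [← Nat.card_congr (Equiv.sigmaFiberEquiv f), ← Nat.card_congr (Equiv.sigmaFiberEquiv g),
    Nat.card_sigma, Nat.card_sigma]
  refine Finset.sum_congr rfl fun w _ => ?_
  by_cases hw : P w
  · exact fib w hw
  · have e1 : IsEmpty {a // f a = w} := ⟨fun a => hw (a.2 ▸ hf a)⟩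
    have e2 : IsEmpty {b // g b = w} := ⟨fun b => hw (b.2 ▸ hg b)⟩
    simp

section LinearMaps

variable {K V W : Type*} [Field K] [AddCommGroup V] [Module K V] [AddCommGroup W] [Module K W]

theorem Module.natCard_linearMap [FiniteDimensional K V] :
    Nat.card (V →ₗ[K] W) = Nat.card W ^ Module.finrank K V := by
  rw [← Nat.card_congr ((Module.finBasis K V).constr ℕ (M' := W)).toEquiv, Nat.card_fun,
    Nat.card_fin]

/-- Linear maps with image in `W` are linear maps into `W`. -/
def LinearMap.rangeLeEquiv (W : Submodule K V) {U : Type*} [AddCommGroup U] [Module K U] :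
    {g : U →ₗ[K] V // LinearMap.range g ≤ W} ≃ (U →ₗ[K] W) where
  toFun g := g.1.codRestrict W fun x => g.2 ⟨x, rfl⟩
  invFun g := ⟨W.subtype ∘ₗ g, by rintro _ ⟨x, rfl⟩; exact (g x).2⟩
  left_inv g := by ext; rfl
  right_inv g := by ext; rfl

/-- An endomorphism with image in `W` is nilpotent as soon as its restriction to `W` is. -/
theorem LinearMap.isNilpotent_subtype_comp_iff (W : Submodule K V) (g : V →ₗ[K] W) :
    IsNilpotent (W.subtype ∘ₗ g : Module.End K V) ↔
      IsNilpotent (g ∘ₗ W.subtype : Module.End K W) := by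
  have key (k : ℕ) (x : V) : ((W.subtype ∘ₗ g : Module.End K V) ^ (k + 1)) x =
      (((g ∘ₗ W.subtype : Module.End K W) ^ k) (g x) : W) := by
    induction k generalizing x with
    | zero => simp
    | succ k ih =>
      rw [pow_succ, Module.End.mul_apply, ih, pow_succ (g ∘ₗ W.subtype : Module.End K W)]
      rfl
  constructor
  · rintro ⟨k, hk⟩
    refine ⟨k + 1, LinearMap.ext fun w => Subtype.ext ?_⟩
    rw [pow_succ, Module.End.mul_apply]
    have := key k w
    rw [pow_succ, hk] at this
    simpa using this.symm
  · rintro ⟨k, hk⟩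
    refine ⟨k + 1, LinearMap.ext fun x => ?_⟩
    rw [key, hk]
    simp

/-- Counting the nilpotent endomorphisms with image in `W`: such a map is a nilpotent
endomorphism of `W` together with an arbitrary linear map from a complement of `W` to `W`. -/
theorem LinearMap.natCard_isNilpotent_range_le [FiniteDimensional K V] (W : Submodule K V) :
    Nat.card {T : Module.End K V // IsNilpotent T ∧ LinearMap.range T ≤ W} =
      Nat.card {T : Module.End K W // IsNilpotent T} *
        Nat.card W ^ (Module.finrank K V - Module.finrank K W) := by
  obtain ⟨W', hW⟩ := W.exists_isCompl
  have hfin : Module.finrank K V - Module.finrank K W = Module.finrank K W' := by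
    have := Submodule.finrank_add_eq_of_isCompl hW
    omega
  let e : (V →ₗ[K] W) ≃ (Module.End K W) × (W' →ₗ[K] W) :=
    ((Submodule.prodEquivOfIsCompl W W' hW).symm.congrLeft W K).toEquiv.trans
      (LinearMap.coprodEquiv (R := K) (S := K) (M := W) (M₂ := W') (M₃ := W)).symm.toEquiv
  have he (g : V →ₗ[K] W) : (e g).1 = g ∘ₗ W.subtype := by
    ext w
    simp [e, LinearMap.coprodEquiv, LinearEquiv.congrLeft]
  rw [hfin, ← Module.natCard_linearMap (K := K) (V := W') (W := W), ← Nat.card_prod]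
  refine Nat.card_congr ?_
  calc {T : Module.End K V // IsNilpotent T ∧ LinearMap.range T ≤ W}
      ≃ {T : {T : Module.End K V // LinearMap.range T ≤ W} // IsNilpotent T.1} :=
        (Equiv.subtypeEquivRight fun _ => And.comm).trans
          (Equiv.subtypeSubtypeEquivSubtypeInter _ _).symm
    _ ≃ {x : Module.End K W × (W' →ₗ[K] W) // IsNilpotent x.1} :=
        ((LinearMap.rangeLeEquiv W).trans e).subtypeEquiv fun T => by
          rw [Equiv.trans_apply, he, ← LinearMap.isNilpotent_subtype_comp_iff]
          rfl
    _ ≃ {T : Module.End K W // IsNilpotent T} × (W' →ₗ[K] W) :=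
        { toFun := fun x => (⟨x.1.1, x.2⟩, x.1.2)
          invFun := fun x => ⟨(x.1.1, x.2), x.1.2⟩
          left_inv := fun _ => rfl
          right_inv := fun _ => rfl }

/-- The Fine–Herstein theorem: a uniformly random endomorphism of a finite vector space `V` is
nilpotent with probability `1 / |V|`. -/
theorem Module.End.natCard_isNilpotent_mul_natCard [Finite K] [FiniteDimensional K V] :
    Nat.card {T : Module.End K V // IsNilpotent T} * Nat.card V = Nat.card (Module.End K V) := by
  induction hn : Module.finrank K V using Nat.strong_induction_on generalizing V with
  | _ n ih =>
    have : Finite V := Module.finite_of_finite K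
    have : Finite (Module.End K V) := Module.finite_of_finite K
    rw [Module.natCard_linearMap, hn]
    rcases n with _ | m
    · have : Subsingleton V := Module.finrank_zero_iff.1 hn
      have : Unique {T : Module.End K V // IsNilpotent T} :=
        { default := ⟨0, IsNilpotent.zero⟩, uniq := fun T => Subtype.ext (Subsingleton.elim _ _) }
      simp
    · rw [pow_succ]
      congr 1
      have hU : Nat.card ((Fin m → K) →ₗ[K] V) = Nat.card V ^ m := by
        rw [Module.natCard_linearMap, Module.finrank_fin_fun]
      have : Finite ((Fin m → K) →ₗ[K] V) := Module.finite_of_finite K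
      have : Finite (Submodule K V) :=
        _root_.Finite.of_injective _ (SetLike.coe_injective (A := Submodule K V))
      rw [← hU]
      refine Nat.card_eq_of_card_le_eq (α := Submodule K V) (fun T => LinearMap.range T.1)
        (fun g => LinearMap.range g) (· < ⊤) (fun v w h1 h2 => h1.trans_lt h2) ?_ ?_ ?_
      · -- a surjective nilpotent endomorphism would be a nilpotent unit
        rintro ⟨T, k, hk⟩
        refine lt_top_iff_ne_top.2 fun h => ?_
        have hs : Function.Surjective (T ^ k) := by
          rw [Module.End.coe_pow]
          exact (LinearMap.range_eq_top.1 h).iterate k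
        have : Nontrivial V := Module.nontrivial_of_finrank_pos (R := K) (by omega)
        obtain ⟨v, hv⟩ := exists_ne (0 : V)
        obtain ⟨u, hu⟩ := hs v
        rw [hk] at hu
        exact hv hu.symm
      · intro g
        refine lt_top_iff_ne_top.2 fun h => ?_
        have := LinearMap.finrank_range_le g
        rw [h, finrank_top, hn, Module.finrank_fin_fun] at this
        omega
      · intro W hW
        have hlt := Submodule.finrank_lt hW.ne
        have hpos : 0 < Nat.card W := Nat.card_pos
        have hWn := ih _ (hn ▸ hlt) (V := W) rfl
        rw [Module.natCard_linearMap] at hWn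
        rw [Nat.card_congr (LinearMap.rangeLeEquiv W), Module.natCard_linearMap,
          Module.finrank_fin_fun,
          Nat.card_congr (Equiv.subtypeSubtypeEquivSubtypeInter
            (fun T : Module.End K V => IsNilpotent T) (fun T => LinearMap.range T ≤ W)),
          LinearMap.natCard_isNilpotent_range_le]
        refine Nat.eq_of_mul_eq_mul_right hpos ?_
        rw [mul_right_comm, hWn, ← pow_add, ← pow_succ]
        congr 1
        omega

theorem Matrix.natCard_isNilpotent_mul_natCard [Finite K] {ι : Type*} [Fintype ι]
    [DecidableEq ι] :
    Nat.card {A : Matrix ι ι K // IsNilpotent A} * Nat.card (ι → K) =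
      Nat.card (Matrix ι ι K) := by
  have e := Matrix.toLinAlgEquiv' (R := K) (n := ι)
  rw [Nat.card_congr e.toEquiv, ← Module.End.natCard_isNilpotent_mul_natCard]
  congr 1
  exact Nat.card_congr (e.toEquiv.subtypeEquiv fun A => (IsNilpotent.map_iff e.injective).symm)

end LinearMaps

/-! ### Proportions of nilpotent elements in finite rings -/

section NilpotentCounting

/-- The fibres of a surjective ring homomorphism all have the cardinality of its kernel. -/
theorem Nat.card_subtype_comp_ringHom {R S : Type*} [Ring R] [Ring S]
    (φ : R →+* S) (hφ : Function.Surjective φ) (P : S → Prop) :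
    Nat.card {a // P (φ a)} = Nat.card {s // P s} * Nat.card (RingHom.ker φ) := by
  rw [← Nat.card_prod]
  refine Nat.card_congr
    { toFun := fun a => (⟨φ a.1, a.2⟩, ⟨a.1 - Function.surjInv hφ (φ a.1), ?_⟩)
      invFun := fun x => ⟨Function.surjInv hφ x.1.1 + x.2.1, ?_⟩
      left_inv := fun a => ?_
      right_inv := fun x => ?_ }
  · simp [RingHom.mem_ker, Function.surjInv_eq hφ]
  · rw [map_add, Function.surjInv_eq hφ, RingHom.mem_ker.1 x.2.2, add_zero]
    exact x.1.2
  · simp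
  · have h : φ (Function.surjInv hφ x.1.1 + x.2.1) = x.1.1 := by
      rw [map_add, Function.surjInv_eq hφ, RingHom.mem_ker.1 x.2.2, add_zero]
    ext <;> simp [h]

/-- A surjective ring homomorphism that reflects nilpotency preserves the proportion of nilpotent
elements. -/
theorem Nat.card_isNilpotent_mul_card_of_surjective {R S : Type*} [Ring R] [Ring S]
    (φ : R →+* S) (hφ : Function.Surjective φ) (h : ∀ a, IsNilpotent (φ a) → IsNilpotent a) :
    Nat.card {a : R // IsNilpotent a} * Nat.card S =
      Nat.card {s : S // IsNilpotent s} * Nat.card R := by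
  have h1 := Nat.card_subtype_comp_ringHom φ hφ IsNilpotent
  have h2 := Nat.card_subtype_comp_ringHom φ hφ fun _ => True
  rw [Nat.card_congr (Equiv.subtypeUnivEquiv fun _ => trivial),
    Nat.card_congr (Equiv.subtypeUnivEquiv fun _ => trivial)] at h2
  rw [Nat.card_congr (Equiv.subtypeEquivRight fun a => ⟨fun ha => ha.map φ, h a⟩), h1, h2]
  ring

theorem Pi.isNilpotent_iff_of_finite {ι : Type*} [Finite ι] {R : ι → Type*}
    [∀ i, MonoidWithZero (R i)] {x : ∀ i, R i} : IsNilpotent x ↔ ∀ i, IsNilpotent (x i) := by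
  have := Fintype.ofFinite ι
  refine ⟨fun ⟨k, hk⟩ i => ⟨k, congr_fun hk i⟩, fun h => ?_⟩
  choose k hk using h
  refine ⟨∑ i, k i, funext fun i => ?_⟩
  exact pow_eq_zero_of_le (Finset.single_le_sum (f := k) (fun _ _ => Nat.zero_le _)
    (Finset.mem_univ i)) (hk i)

namespace Matrix

variable {σ α K : Type*} [Fintype σ] [LinearOrder α] {b : σ → α}

theorem BlockTriangular.toSquareBlock_mul [NonUnitalNonAssocSemiring K] {A B : Matrix σ σ K}
    (hA : A.BlockTriangular b) (hB : B.BlockTriangular b) (k : α) :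
    (A * B).toSquareBlock b k = A.toSquareBlock b k * B.toSquareBlock b k := by
  ext ⟨i, hi⟩ ⟨j, hj⟩
  simp only [toSquareBlock_def, of_apply, mul_apply]
  rw [← Finset.sum_subtype (Finset.univ.filter fun x => b x = k) (by simp)
    (fun x => A i x * B x j), Finset.sum_filter]
  refine Finset.sum_congr rfl fun x _ => ?_
  split_ifs with hx
  · rfl
  · rcases lt_or_gt_of_ne hx with hx | hx
    · rw [hA (by rwa [hi]), zero_mul]
    · rw [hB (by rwa [hj]), mul_zero]

/-- If the diagonal blocks are nilpotent then the characteristic polynomial, which is the product of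
theirs, is a power of `X`. -/
theorem BlockTriangular.isNilpotent [DecidableEq σ] [Field K] {A : Matrix σ σ K}
    (hA : A.BlockTriangular b) (h : ∀ k, IsNilpotent (A.toSquareBlock b k)) :
    IsNilpotent A := by
  have h1 (k : α) : (A.toSquareBlock b k).charpoly =
      Polynomial.X ^ Fintype.card {i // b i = k} :=
    sub_eq_zero.1 (isNilpotent_charpoly_sub_pow_of_isNilpotent (h k)).eq_zero
  refine ⟨∑ k ∈ Finset.univ.image b, Fintype.card {i // b i = k}, ?_⟩
  have h2 := aeval_self_charpoly A
  rwa [hA.charpoly, Finset.prod_congr rfl fun k _ => h1 k, Finset.prod_pow_eq_pow_sum, map_pow,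
    Polynomial.aeval_X] at h2

end Matrix

/-- Nilpotent elements in a finite product of matrix algebras, one for each fibre of `b`: the
proportion is the product of the proportions in the factors. -/
theorem Matrix.natCard_isNilpotent_pi_mul {σ α K : Type*} [Fintype σ] [DecidableEq σ]
    [Finite α] [DecidableEq α] [Field K] [Finite K] (b : σ → α) :
    Nat.card {A : ∀ k, Matrix {i // b i = k} {i // b i = k} K // IsNilpotent A} *
      Nat.card (σ → K) = Nat.card (∀ k, Matrix {i // b i = k} {i // b i = k} K) := by
  have := Fintype.ofFinite α
  rw [Nat.card_congr (Equiv.subtypeEquivRight fun _ => Pi.isNilpotent_iff_of_finite),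
    Nat.card_congr Equiv.subtypePiEquivPi,
    Nat.card_congr ((Equiv.sigmaFiberEquiv b).symm.arrowCongr (Equiv.refl K)),
    Nat.card_congr (Equiv.piCurry fun _ _ => K)]
  iterate 3 rw [Nat.card_pi (α := α)]
  rw [← Finset.prod_mul_distrib]
  exact Finset.prod_congr rfl fun k _ => Matrix.natCard_isNilpotent_mul_natCard

end NilpotentCounting

/-! ### The centralizer of the shift and its action on the socle -/

namespace Matrix

section Shift

variable {σ K : Type*} {l : σ → ℕ}

/-- The matrix of multiplication by `t` on `⨁ s, K[t] / (t ^ l s)`, in the basis of the powers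
`t ^ j`: it sends the basis vector `(s, j)` to `(s, j + 1)`, and to zero if `j + 1 = l s`. -/
def shift [DecidableEq σ] (K : Type*) [Zero K] [One K] (l : σ → ℕ) :
    Matrix (Σ s, Fin (l s)) (Σ s, Fin (l s)) K :=
  of fun x y => if x.1 = y.1 ∧ (x.2 : ℕ) = y.2 + 1 then 1 else 0

/-- The entries of the `(r, s)` block of `T`, with rows numbered from the bottom, extended by
zero to all pairs of natural numbers. -/
def revEntry [Zero K] (T : Matrix (Σ s, Fin (l s)) (Σ s, Fin (l s)) K) (r s : σ) (a j : ℕ) : K :=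
  if h : a < l r ∧ j < l s then T ⟨r, ⟨l r - 1 - a, by omega⟩⟩ ⟨s, ⟨j, h.2⟩⟩ else 0

theorem revEntry_of_lt [Zero K] (T : Matrix (Σ s, Fin (l s)) (Σ s, Fin (l s)) K) (r s : σ)
    {a j : ℕ} (ha : a < l r) (hj : j < l s) :
    revEntry T r s a j = T ⟨r, ⟨l r - 1 - a, by omega⟩⟩ ⟨s, ⟨j, hj⟩⟩ :=
  dif_pos ⟨ha, hj⟩

theorem revEntry_of_le_left [Zero K] (T : Matrix (Σ s, Fin (l s)) (Σ s, Fin (l s)) K) (r s : σ)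
    {a j : ℕ} (ha : l r ≤ a) : revEntry T r s a j = 0 :=
  dif_neg fun h => by omega

theorem revEntry_of_le_right [Zero K] (T : Matrix (Σ s, Fin (l s)) (Σ s, Fin (l s)) K) (r s : σ)
    {a j : ℕ} (hj : l s ≤ j) : revEntry T r s a j = 0 :=
  dif_neg fun h => by omega

theorem apply_eq_revEntry [Zero K] (T : Matrix (Σ s, Fin (l s)) (Σ s, Fin (l s)) K) (r s : σ)
    (a : Fin (l r)) (j : Fin (l s)) : T ⟨r, a⟩ ⟨s, j⟩ = revEntry T r s (l r - 1 - a) j := by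
  have ha : l r - 1 - (l r - 1 - a) = a := by omega
  rw [revEntry_of_lt T r s (by omega) j.2]
  simp only [ha]

variable (l) in
/-- The matrix whose `(r, s)` block, with rows numbered from the bottom, is the Hankel matrix of
the sequence `c r s`. -/
def hankel [Zero K] (c : ∀ r s : σ, Fin (min (l r) (l s)) → K) :
    Matrix (Σ s, Fin (l s)) (Σ s, Fin (l s)) K :=
  of fun x y =>
    if h : l x.1 - 1 - x.2 + y.2 < min (l x.1) (l y.1) then c x.1 y.1 ⟨_, h⟩ else 0

theorem revEntry_hankel [Zero K] (c : ∀ r s : σ, Fin (min (l r) (l s)) → K) (r s : σ) {a j : ℕ}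
    (ha : a < l r) (hj : j < l s) : revEntry (hankel l c) r s a j =
      if h : a + j < min (l r) (l s) then c r s ⟨a + j, h⟩ else 0 := by
  have h1 : l r - 1 - (l r - 1 - a) = a := by omega
  rw [revEntry_of_lt _ r s ha hj]
  simp only [hankel, of_apply, h1]

variable [DecidableEq σ] [Fintype σ]

theorem mul_shift_apply [NonAssocSemiring K] (T : Matrix (Σ s, Fin (l s)) (Σ s, Fin (l s)) K)
    {r s : σ} {a j : ℕ} (ha : a < l r) (hj : j < l s) :
    (T * shift K l) ⟨r, ⟨l r - 1 - a, by omega⟩⟩ ⟨s, ⟨j, hj⟩⟩ = revEntry T r s a (j + 1) := by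
  rw [mul_apply]
  simp only [shift, of_apply, mul_ite, mul_one, mul_zero]
  by_cases h : j + 1 < l s
  · rw [revEntry_of_lt T r s ha h, Finset.sum_eq_single ⟨s, ⟨j + 1, h⟩⟩]
    · simp
    · rintro ⟨u, k⟩ _ hne
      refine if_neg ?_
      rintro ⟨rfl, hk⟩
      exact hne (by congr 1; ext; exact hk)
    · simp
  · rw [revEntry_of_le_right T r s (by omega)]
    refine Finset.sum_eq_zero ?_
    rintro ⟨u, k⟩ _
    refine if_neg ?_
    rintro ⟨rfl, hk⟩
    have := k.2
    dsimp only at hk h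
    omega

theorem shift_mul_apply [NonAssocSemiring K] (T : Matrix (Σ s, Fin (l s)) (Σ s, Fin (l s)) K)
    {r s : σ} {a j : ℕ} (ha : a < l r) (hj : j < l s) :
    (shift K l * T) ⟨r, ⟨l r - 1 - a, by omega⟩⟩ ⟨s, ⟨j, hj⟩⟩ = revEntry T r s (a + 1) j := by
  rw [mul_apply]
  simp only [shift, of_apply, ite_mul, one_mul, zero_mul]
  by_cases h : a + 1 < l r
  · rw [revEntry_of_lt T r s h hj, Finset.sum_eq_single ⟨r, ⟨l r - 1 - (a + 1), by omega⟩⟩]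
    · rw [if_pos ⟨rfl, by dsimp only; omega⟩]
    · rintro ⟨u, k⟩ _ hne
      refine if_neg ?_
      rintro ⟨rfl, hk⟩
      dsimp only at hk
      exact hne (by congr 1; ext; dsimp only; omega)
    · simp
  · rw [revEntry_of_le_left T r s (by omega)]
    refine Finset.sum_eq_zero ?_
    rintro ⟨u, k⟩ _
    refine if_neg ?_
    rintro ⟨rfl, hk⟩
    dsimp only at hk
    omega

theorem commute_shift_iff [NonAssocSemiring K] {T : Matrix (Σ s, Fin (l s)) (Σ s, Fin (l s)) K} :
    Commute T (shift K l) ↔ ∀ r s a j, a < l r → j < l s →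
      revEntry T r s a (j + 1) = revEntry T r s (a + 1) j := by
  constructor
  · intro h r s a j ha hj
    rw [← mul_shift_apply T ha hj, ← shift_mul_apply T ha hj, h.eq]
  · intro h
    ext ⟨r, a⟩ ⟨s, j⟩
    have ha : l r - 1 - (l r - 1 - a) = a := by omega
    have := h r s (l r - 1 - a) j (by omega) j.2
    rw [← mul_shift_apply T (by omega) j.2, ← shift_mul_apply T (by omega) j.2] at this
    simpa only [ha] using this

/-- With rows numbered from the bottom, the blocks of a matrix commuting with the shift are
Hankel matrices. -/
theorem revEntry_eq_of_commute [NonAssocSemiring K]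
    {T : Matrix (Σ s, Fin (l s)) (Σ s, Fin (l s)) K} (h : Commute T (shift K l)) (r s : σ)
    {a j : ℕ} (hj : j < l s) :
    revEntry T r s a j = revEntry T r s (a + j) 0 := by
  induction j generalizing a with
  | zero => rfl
  | succ j ih =>
    by_cases ha : a < l r
    · rw [commute_shift_iff.1 h r s a j ha (by omega), ih (by omega)]
      congr 1
      omega
    · rw [revEntry_of_le_left T r s (by omega), revEntry_of_le_left T r s (by omega)]

/-- In the last column the shift relation reads zero on one side, so the Hankel sequence of a
block vanishes from the number of columns on; from the number of rows on it does so by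
definition. -/
theorem revEntry_eq_zero_of_commute [NonAssocSemiring K]
    {T : Matrix (Σ s, Fin (l s)) (Σ s, Fin (l s)) K} (h : Commute T (shift K l)) (r s : σ)
    {x : ℕ} (hx : min (l r) (l s) ≤ x) :
    revEntry T r s x 0 = 0 := by
  by_cases hr : x < l r
  · by_cases hs : l s = 0
    · exact revEntry_of_le_right T r s (by omega)
    · have h1 := commute_shift_iff.1 h r s (x - l s) (l s - 1) (by omega) (by omega)
      rw [revEntry_of_le_right T r s (by omega), revEntry_eq_of_commute h r s (by omega)] at h1
      rw [h1]
      congr 1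
      omega
  · exact revEntry_of_le_left T r s (by omega)

theorem hankel_commute_shift [NonAssocSemiring K] (c : ∀ r s : σ, Fin (min (l r) (l s)) → K) :
    Commute (hankel l c) (shift K l) := by
  refine commute_shift_iff.2 fun r s a j ha hj => ?_
  by_cases h1 : a + 1 < l r <;> by_cases h2 : j + 1 < l s
  · rw [revEntry_hankel c r s ha h2, revEntry_hankel c r s h1 hj]
    simp only [Nat.add_assoc, Nat.add_comm 1 j]
  · rw [revEntry_of_le_right _ r s (by omega), revEntry_hankel c r s h1 hj, dif_neg (by omega)]
  · rw [revEntry_hankel c r s ha h2, revEntry_of_le_left _ r s (by omega), dif_neg (by omega)]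
  · rw [revEntry_of_le_right _ r s (by omega), revEntry_of_le_left _ r s (by omega)]

/-- A matrix commuting with the shift is given by a Hankel sequence of length `min (l r) (l s)`
for each block. -/
def commuteShiftEquiv [NonAssocSemiring K] :
    {T : Matrix (Σ s, Fin (l s)) (Σ s, Fin (l s)) K // Commute T (shift K l)} ≃
      (∀ r s : σ, Fin (min (l r) (l s)) → K) where
  toFun T r s x := revEntry T.1 r s x 0
  invFun c := ⟨hankel l c, hankel_commute_shift c⟩
  left_inv T := by
    ext ⟨r, a⟩ ⟨s, j⟩
    refine (apply_eq_revEntry _ r s a j).trans (Eq.trans ?_ (apply_eq_revEntry T.1 r s a j).symm)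
    rw [revEntry_hankel _ r s (by omega) j.2, revEntry_eq_of_commute T.2 r s j.2]
    split_ifs with h
    · rfl
    · exact (revEntry_eq_zero_of_commute T.2 r s (by omega)).symm
  right_inv c := by
    ext r s x
    have := x.2
    dsimp only
    rw [revEntry_hankel c r s (by omega) (by omega), dif_pos (by omega)]
    rfl

theorem natCard_commute_shift [NonAssocSemiring K] :
    Nat.card {T : Matrix (Σ s, Fin (l s)) (Σ s, Fin (l s)) K // Commute T (shift K l)} =
      Nat.card K ^ ∑ r, ∑ s, min (l r) (l s) := by
  rw [Nat.card_congr commuteShiftEquiv, Nat.card_pi, ← Finset.prod_pow_eq_pow_sum]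
  refine Finset.prod_congr rfl fun r _ => ?_
  rw [Nat.card_pi, ← Finset.prod_pow_eq_pow_sum]
  refine Finset.prod_congr rfl fun s _ => ?_
  rw [Nat.card_fun, Nat.card_fin]

theorem shift_pow_apply [Semiring K] (k : ℕ) (x y : Σ s, Fin (l s)) (h : (x.2 : ℕ) < y.2 + k) :
    (shift K l ^ k) x y = 0 := by
  induction k generalizing x with
  | zero =>
    refine one_apply_ne ?_
    rintro rfl
    omega
  | succ k ih =>
    rw [pow_succ', mul_apply]
    refine Finset.sum_eq_zero fun z _ => ?_
    by_cases hz : x.1 = z.1 ∧ (x.2 : ℕ) = z.2 + 1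
    · rw [ih z (by omega), mul_zero]
    · rw [shift, of_apply, if_neg hz, zero_mul]

theorem shift_pow_eq_zero [Semiring K] {k : ℕ} (h : ∀ s, l s ≤ k) : shift K l ^ k = 0 := by
  ext x y
  have := h x.1
  exact shift_pow_apply k x y (by omega)

theorem isNilpotent_shift [Semiring K] : IsNilpotent (shift K l) :=
  ⟨∑ s, l s, shift_pow_eq_zero fun s =>
    Finset.single_le_sum (f := l) (fun _ _ => Nat.zero_le _) (Finset.mem_univ s)⟩

end Shift

section Socle

variable {σ K : Type*} {l : σ → ℕ}

/-- The index of the socle vector `t ^ (l s - 1)` of the summand `K[t] / (t ^ l s)`. -/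
def socleIdx (hl : ∀ s, 0 < l s) (s : σ) : Σ s, Fin (l s) :=
  ⟨s, ⟨l s - 1, Nat.sub_one_lt (hl s).ne'⟩⟩

/-- The submatrix on the socle indices: for a matrix commuting with the shift, the matrix of its
restriction to the socle. -/
def socleBlock (hl : ∀ s, 0 < l s) (T : Matrix (Σ s, Fin (l s)) (Σ s, Fin (l s)) K) :
    Matrix σ σ K :=
  T.submatrix (socleIdx hl) (socleIdx hl)

theorem socleBlock_apply [Zero K] (hl : ∀ s, 0 < l s)
    (T : Matrix (Σ s, Fin (l s)) (Σ s, Fin (l s)) K) (r s : σ) :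
    socleBlock hl T r s = revEntry T r s 0 (l s - 1) := by
  rw [revEntry_of_lt T r s (hl r) (Nat.sub_one_lt (hl s).ne')]
  rfl

theorem socleBlock_one [DecidableEq σ] [Zero K] [One K] (hl : ∀ s, 0 < l s) :
    socleBlock hl (1 : Matrix (Σ s, Fin (l s)) (Σ s, Fin (l s)) K) = 1 :=
  submatrix_one _ fun _ _ h => congr_arg Sigma.fst h

variable [DecidableEq σ] [Fintype σ]

/-- The socle is preserved by a matrix commuting with the shift. -/
theorem apply_socleIdx_eq_zero [NonAssocSemiring K] (hl : ∀ s, 0 < l s)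
    {T : Matrix (Σ s, Fin (l s)) (Σ s, Fin (l s)) K} (h : Commute T (shift K l))
    {x : Σ s, Fin (l s)} (hx : x ≠ socleIdx hl x.1) (s : σ) : T x (socleIdx hl s) = 0 := by
  have hs := hl s
  obtain ⟨r, a⟩ := x
  have ha : (a : ℕ) ≠ l r - 1 := fun e => hx (by rw [socleIdx]; congr 1; ext; exact e)
  refine (apply_eq_revEntry T r s a _).trans ?_
  rw [revEntry_eq_of_commute h r s (by dsimp only; omega)]
  exact revEntry_eq_zero_of_commute h r s (by dsimp only; omega)

theorem socleBlock_mul [NonAssocSemiring K] (hl : ∀ s, 0 < l s)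
    {T U : Matrix (Σ s, Fin (l s)) (Σ s, Fin (l s)) K} (hU : Commute U (shift K l)) :
    socleBlock hl (T * U) = socleBlock hl T * socleBlock hl U := by
  ext r s
  simp only [socleBlock, submatrix_apply, mul_apply]
  rw [← Finset.sum_image (s := Finset.univ) (g := socleIdx hl)
    (f := fun z => T (socleIdx hl r) z * U z (socleIdx hl s))]
  · refine (Finset.sum_subset (Finset.subset_univ _) fun z _ hz => ?_).symm
    rw [apply_socleIdx_eq_zero hl hU, mul_zero]
    exact fun e => hz (Finset.mem_image.2 ⟨z.1, Finset.mem_univ _, e.symm⟩)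
  · exact fun a _ b _ h => congr_arg Sigma.fst h

theorem socleBlock_pow [Semiring K] (hl : ∀ s, 0 < l s)
    {T : Matrix (Σ s, Fin (l s)) (Σ s, Fin (l s)) K} (hT : Commute T (shift K l)) (k : ℕ) :
    socleBlock hl (T ^ k) = socleBlock hl T ^ k := by
  induction k with
  | zero => rw [pow_zero, pow_zero, socleBlock_one]
  | succ k ih => rw [pow_succ, socleBlock_mul hl hT, ih, pow_succ]

/-- The filtration of the socle by the powers of `t` is preserved by a matrix commuting with the
shift. The order on the exponents is reversed because the `r`-th component of the image of the
`s`-th socle vector can be nonzero only if `l s ≤ l r`. -/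
theorem blockTriangular_socleBlock [NonAssocSemiring K] (hl : ∀ s, 0 < l s)
    {T : Matrix (Σ s, Fin (l s)) (Σ s, Fin (l s)) K} (hT : Commute T (shift K l)) :
    (socleBlock hl T).BlockTriangular fun s => OrderDual.toDual (Set.rangeFactorization l s) := by
  intro r s h
  have h' : l r < l s := h
  have := hl s
  rw [socleBlock_apply, revEntry_eq_of_commute hT r s (by omega)]
  exact revEntry_eq_zero_of_commute hT r s (by omega)

/-- A matrix `T` commuting with the shift `S` and vanishing on the socle `ker S` is nilpotent:
`T` factors as `W * S`, and then `T ^ k = W ^ k * S ^ k` by induction. -/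
theorem isNilpotent_of_socleBlock_eq_zero [Semiring K] (hl : ∀ s, 0 < l s)
    {T : Matrix (Σ s, Fin (l s)) (Σ s, Fin (l s)) K} (hT : Commute T (shift K l))
    (h : socleBlock hl T = 0) : IsNilpotent T := by
  have hcol (x : Σ s, Fin (l s)) (s : σ) : T x (socleIdx hl s) = 0 := by
    by_cases hx : x = socleIdx hl x.1
    · rw [hx]
      exact congr_fun₂ h x.1 s
    · exact apply_socleIdx_eq_zero hl hT hx s
  -- `Sᵀ * S` is the projection that forgets the socle coordinates
  have hproj : (shift K l)ᵀ * shift K l =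
      diagonal fun x : Σ s, Fin (l s) => if (x.2 : ℕ) + 1 < l x.1 then 1 else 0 := by
    ext x y
    rw [mul_apply]
    simp only [transpose_apply, shift, of_apply, diagonal_apply, ← ite_and, mul_ite, mul_one,
      mul_zero]
    by_cases hxy : x = y
    · subst hxy
      by_cases hx : (x.2 : ℕ) + 1 < l x.1
      · rw [if_pos ⟨rfl, hx⟩, Finset.sum_eq_single ⟨x.1, ⟨x.2 + 1, hx⟩⟩]
        · simp
        · rintro ⟨u, k⟩ _ hne
          refine if_neg ?_
          rintro ⟨⟨rfl, hk⟩, -⟩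
          exact hne (by congr 1; ext; exact hk)
        · simp
      · rw [if_neg fun h => hx h.2]
        refine Finset.sum_eq_zero fun z _ => if_neg ?_
        obtain ⟨u, k⟩ := z
        rintro ⟨⟨rfl, hk⟩, -⟩
        have := k.2
        dsimp only at hk this
        omega
    · rw [if_neg fun h => hxy h.1]

      refine Finset.sum_eq_zero fun z _ => if_neg ?_
      obtain ⟨u, k⟩ := z
      obtain ⟨r, a⟩ := x
      obtain ⟨s, j⟩ := y
      rintro ⟨⟨rfl, h1⟩, ⟨rfl, h2⟩⟩
      exact hxy (by congr 1; ext; dsimp only at h1 h2; omega)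
  have hW : T = T * (shift K l)ᵀ * shift K l := by
    rw [mul_assoc, hproj]
    ext x ⟨s, j⟩
    rw [mul_diagonal]
    split_ifs with hj
    · rw [mul_one]
    · have : (⟨s, j⟩ : Σ s, Fin (l s)) = socleIdx hl s := by
        rw [socleIdx]
        congr 1
        ext
        dsimp only at hj ⊢
        omega
      rw [this, hcol, zero_mul]
  have hpow (k : ℕ) : T ^ k = (T * (shift K l)ᵀ) ^ k * shift K l ^ k := by
    induction k with
    | zero => simp
    | succ k ih =>
      rw [pow_succ, ih, mul_assoc, ← (hT.pow_right k).eq, ← mul_assoc]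
      nth_rw 2 [hW]
      rw [pow_succ, pow_succ']
      simp only [mul_assoc]
  obtain ⟨k, hk⟩ := isNilpotent_shift (K := K) (l := l)
  exact ⟨k, by rw [hpow, hk, mul_zero]⟩

variable (K l) in
/-- The action of the centralizer of the shift on the graded pieces of the socle, filtered by
the powers of `t`. -/
def socleBlocks [Ring K] (hl : ∀ s, 0 < l s) :
    Subring.centralizer {shift K l} →+*
      ∀ k : (Set.range l)ᵒᵈ, Matrix {s // OrderDual.toDual (Set.rangeFactorization l s) = k}
        {s // OrderDual.toDual (Set.rangeFactorization l s) = k} K where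
  toFun T k := (socleBlock hl T.1).toSquareBlock _ k
  map_one' := by
    funext k
    rw [Subring.coe_one, socleBlock_one]
    exact submatrix_one _ Subtype.val_injective
  map_mul' T U := by
    have hT : Commute T.1 (shift K l) := (Subring.mem_centralizer_iff.1 T.2 _ rfl).symm
    have hU : Commute U.1 (shift K l) := (Subring.mem_centralizer_iff.1 U.2 _ rfl).symm
    funext k
    rw [Subring.coe_mul, socleBlock_mul hl hU]
    exact (blockTriangular_socleBlock hl hT).toSquareBlock_mul (blockTriangular_socleBlock hl hU) k
  map_zero' := rfl
  map_add' _ _ := rfl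

theorem socleBlocks_surjective [Ring K] (hl : ∀ s, 0 < l s) :
    Function.Surjective (socleBlocks K l hl) := by
  intro B
  let c (r s : σ) (_ : Fin (min (l r) (l s))) : K :=
    if h : Set.rangeFactorization l r = Set.rangeFactorization l s then
      B (OrderDual.toDual (Set.rangeFactorization l s)) ⟨r, congr_arg _ h⟩ ⟨s, rfl⟩ else 0
  refine ⟨⟨hankel l c, Subring.mem_centralizer_iff.2 ?_⟩, ?_⟩
  · rintro _ rfl
    exact (hankel_commute_shift c).symm
  · funext k
    ext ⟨r, hr⟩ ⟨s, rfl⟩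
    have h1 : l r = l s := congr_arg Subtype.val hr
    have := hl s
    change socleBlock hl (hankel l c) r s = _
    rw [socleBlock_apply, revEntry_hankel c r s (hl r) (by omega), dif_pos (by omega)]
    exact dif_pos hr

/-- Nilpotency on the graded pieces of the socle gives a power that vanishes on the socle. -/
theorem isNilpotent_of_socleBlocks [Field K] (hl : ∀ s, 0 < l s)
    (T : Subring.centralizer {shift K l}) (h : IsNilpotent (socleBlocks K l hl T)) :
    IsNilpotent T := by
  have hT : Commute T.1 (shift K l) := (Subring.mem_centralizer_iff.1 T.2 _ rfl).symm
  obtain ⟨k, hk⟩ := (blockTriangular_socleBlock hl hT).isNilpotent fun k =>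
    h.map (Pi.evalRingHom _ k)
  rw [← socleBlock_pow hl hT] at hk
  have h1 := isNilpotent_of_socleBlock_eq_zero hl (hT.pow_left k) hk
  exact (IsNilpotent.map_iff (f := (Subring.centralizer {shift K l}).subtype)
    Subtype.val_injective).1 (IsNilpotent.of_pow h1)

/-- Among the endomorphisms of `⨁ s, K[t] / (t ^ l s)` the proportion of nilpotent ones is
`|K| ^ (-|σ|)`. -/
theorem natCard_isNilpotent_commute_shift_mul [Field K] [Finite K] (hl : ∀ s, 0 < l s) :
    Nat.card {T : Matrix (Σ s, Fin (l s)) (Σ s, Fin (l s)) K //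
        IsNilpotent T ∧ Commute T (shift K l)} * Nat.card K ^ Fintype.card σ =
      Nat.card K ^ ∑ r, ∑ s, min (l r) (l s) := by
  classical
  let e : {T : Matrix (Σ s, Fin (l s)) (Σ s, Fin (l s)) K // Commute T (shift K l)} ≃
      Subring.centralizer {shift K l} := Equiv.subtypeEquivRight fun T => by
    rw [Subring.mem_centralizer_iff]
    exact ⟨fun h g hg => by rw [Set.mem_singleton_iff.1 hg]; exact h.symm.eq,
      fun h => (h _ rfl).symm⟩
  have h1 : Nat.card {T : Matrix (Σ s, Fin (l s)) (Σ s, Fin (l s)) K //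
      IsNilpotent T ∧ Commute T (shift K l)} =
      Nat.card {T : Subring.centralizer {shift K l} // IsNilpotent T} := by
    refine Nat.card_congr (((Equiv.subtypeEquivRight fun _ => And.comm).trans
      (Equiv.subtypeSubtypeEquivSubtypeInter _ _).symm).trans (e.subtypeEquiv fun T => ?_))
    exact IsNilpotent.map_iff (f := (Subring.centralizer {shift K l}).subtype)
      Subtype.val_injective (r := e T)
  have h2 := Nat.card_isNilpotent_mul_card_of_surjective (socleBlocks K l hl)
    (socleBlocks_surjective hl) (isNilpotent_of_socleBlocks hl)
  have h3 := Matrix.natCard_isNilpotent_pi_mul (K := K)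
    fun s => OrderDual.toDual (Set.rangeFactorization l s)
  rw [← h3] at h2
  have hpos : 0 < Nat.card {A : ∀ k : (Set.range l)ᵒᵈ,
      Matrix {s // OrderDual.toDual (Set.rangeFactorization l s) = k}
        {s // OrderDual.toDual (Set.rangeFactorization l s) = k} K // IsNilpotent A} := by
    have : Nonempty {A : ∀ k : (Set.range l)ᵒᵈ,
      Matrix {s // OrderDual.toDual (Set.rangeFactorization l s) = k}
        {s // OrderDual.toDual (Set.rangeFactorization l s) = k} K // IsNilpotent A} :=
      ⟨⟨0, IsNilpotent.zero⟩⟩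
    exact Nat.card_pos
  rw [← natCard_commute_shift, Nat.card_congr e, h1, ← Nat.card_eq_fintype_card,
    ← Nat.card_fun]
  refine Nat.eq_of_mul_eq_mul_left hpos ?_
  rw [← h2]
  ring

end Socle

end Matrix

/-! ### Restriction of scalars along a finite field extension -/

section RestrictScalars

open Polynomial

/-- An endomorphism of the `F`-vector space `K = F[θ]` commuting with multiplication by `θ` is
multiplication by an element of `K`. -/
theorem Algebra.exists_leftMulMatrix_eq_of_commute {F K κ : Type*} [Field F] [CommRing K]
    [Algebra F K] [Fintype κ] [DecidableEq κ] (b : Module.Basis κ F K) {θ : K}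
    (hθ : Algebra.adjoin F {θ} = ⊤) {B : Matrix κ κ F}
    (hB : Commute B (Algebra.leftMulMatrix b θ)) : ∃ x, Algebra.leftMulMatrix b x = B := by
  have hall (x : K) : Commute B (Algebra.leftMulMatrix b x) := by
    have hx : x ∈ Algebra.adjoin F {θ} := hθ ▸ Algebra.mem_top
    induction hx using Algebra.adjoin_induction with
    | mem x hx => rwa [Set.mem_singleton_iff.1 hx]
    | algebraMap r => rw [AlgHom.commutes]; exact (Algebra.commutes r B).symm
    | add x y _ _ hx hy => rw [map_add]; exact hx.add_right hy
    | mul x y _ _ hx hy => rw [map_mul]; exact hx.mul_right hy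
  let g := Matrix.toLin b b B
  have hg (x y : K) : g (x * y) = x * g y := by
    have h1 := congr_arg (Matrix.toLin b b) (hall x).eq
    rw [Matrix.toLin_mul b b b, Matrix.toLin_mul b b b, Algebra.leftMulMatrix_apply,
      Matrix.toLin_toMatrix] at h1
    exact LinearMap.congr_fun h1 y
  refine ⟨g 1, (Matrix.toLin b b).injective ?_⟩
  rw [Algebra.leftMulMatrix_apply, Matrix.toLin_toMatrix]
  ext x
  change g 1 * x = g x
  rw [mul_comm, ← hg, mul_one]

namespace Matrix

/-- Restriction of scalars: a `K`-linear endomorphism of `K ^ ι` regarded as an `F`-linear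
endomorphism of `F ^ (ι × κ)`, for a basis of `K` over `F` indexed by `κ`. -/
noncomputable def restrictScalarsHom {F K κ : Type*} [Field F] [CommRing K] [Algebra F K]
    [Fintype κ] [DecidableEq κ] (b : Module.Basis κ F K) (ι : Type*) [Fintype ι]
    [DecidableEq ι] : Matrix ι ι K →ₐ[F] Matrix (ι × κ) (ι × κ) F :=
  (compAlgEquiv ι κ F F).toAlgHom.comp (Algebra.leftMulMatrix b).mapMatrix

variable {F K κ ι : Type*} [Field F] [CommRing K] [Algebra F K] [Fintype κ] [DecidableEq κ]
  (b : Module.Basis κ F K) [Fintype ι] [DecidableEq ι]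

theorem restrictScalarsHom_apply (T : Matrix ι ι K) (x y : ι × κ) :
    restrictScalarsHom b ι T x y = Algebra.leftMulMatrix b (T x.1 y.1) x.2 y.2 := rfl

theorem restrictScalarsHom_injective : Function.Injective (restrictScalarsHom b ι) := by
  intro T U h
  ext i j
  refine Algebra.leftMulMatrix_injective b (Matrix.ext fun k m => ?_)
  exact congr_fun₂ h (i, k) (j, m)

theorem exists_restrictScalarsHom_eq_of_commute {θ : K} (hθ : Algebra.adjoin F {θ} = ⊤)
    {M : Matrix (ι × κ) (ι × κ) F} (hM : Commute M (restrictScalarsHom b ι (scalar ι θ))) :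
    ∃ T, restrictScalarsHom b ι T = M := by
  let M' := (compAlgEquiv ι κ F F).symm M
  have hM' : Commute M' ((Algebra.leftMulMatrix b).mapMatrix (scalar ι θ)) :=
    (compAlgEquiv ι κ F F).injective (by
      rw [map_mul, map_mul, AlgEquiv.apply_symm_apply]; exact hM)
  have hdiag : (Algebra.leftMulMatrix b).mapMatrix (scalar ι θ) =
      diagonal fun _ => Algebra.leftMulMatrix b θ := by
    simp [AlgHom.mapMatrix_apply, scalar_apply, diagonal_map]
  rw [hdiag] at hM'
  have hent (i j : ι) : Commute (M' i j) (Algebra.leftMulMatrix b θ) := by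
    have := congr_fun₂ hM'.eq i j
    rwa [mul_diagonal, diagonal_mul] at this
  choose T hT using fun i j => Algebra.exists_leftMulMatrix_eq_of_commute b hθ (hent i j)
  refine ⟨of T, ?_⟩
  ext ⟨i, k⟩ ⟨j, m⟩
  rw [restrictScalarsHom_apply, of_apply, hT]
  rfl

/-- The Jordan decomposition over a finite field: a scalar matrix is a power of its sum with a
nilpotent matrix, by Frobenius. -/
theorem exists_scalar_add_pow_eq {K ι : Type*} [Field K] [Finite K] [Fintype ι] [DecidableEq ι]
    (θ : K) {N : Matrix ι ι K} (hN : IsNilpotent N) :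
    ∃ k, (scalar ι θ + N) ^ k = scalar ι θ := by
  cases isEmpty_or_nonempty ι
  · exact ⟨0, Subsingleton.elim _ _⟩
  have := Fintype.ofFinite K
  obtain ⟨p, hp⟩ := CharP.exists K
  obtain ⟨m, hprime, hm⟩ := FiniteField.card K p
  have : Fact p.Prime := ⟨hprime⟩
  obtain ⟨k, hk⟩ := hN
  refine ⟨Fintype.card K ^ k, ?_⟩
  have hz : N ^ Fintype.card K ^ k = 0 :=
    pow_eq_zero_of_le (Nat.lt_pow_self Fintype.one_lt_card).le hk
  rw [hm, ← pow_mul] at hz ⊢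
  rw [add_pow_char_pow_of_commute (p := p) (h := scalar_commute θ (Commute.all θ) N), hz,
    add_zero, ← map_pow, pow_mul, ← hm, FiniteField.pow_card_pow]

/-- Over a finite field, the nilpotent matrices commuting with `θ + N`, where `θ` generates the
extension `K` of `F` and `N` is nilpotent over `K`, are those over `K` commuting with `N`. -/
theorem natCard_isNilpotent_commute_restrictScalarsHom {F K κ ι : Type*} [Field F] [Field K]
    [Finite K] [Algebra F K] [Fintype κ] [DecidableEq κ] (b : Module.Basis κ F K) [Fintype ι]
    [DecidableEq ι] {θ : K} (hθ : Algebra.adjoin F {θ} = ⊤) {N : Matrix ι ι K}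
    (hN : IsNilpotent N) :
    Nat.card {M : Matrix (ι × κ) (ι × κ) F //
        IsNilpotent M ∧ Commute M (restrictScalarsHom b ι (scalar ι θ + N))} =
      Nat.card {T : Matrix ι ι K // IsNilpotent T ∧ Commute T N} := by
  have hinj := restrictScalarsHom_injective (ι := ι) b
  have hcomm (T : Matrix ι ι K) : Commute (restrictScalarsHom b ι T)
      (restrictScalarsHom b ι (scalar ι θ + N)) ↔ Commute T N := by
    have hs : Commute T (scalar ι θ) := (scalar_commute θ (Commute.all θ) T).symm
    constructor
    · intro h
      have h1 : Commute T (scalar ι θ + N) := hinj (by rw [map_mul, map_mul]; exact h)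
      simpa using h1.sub_right hs
    · exact fun h => (hs.add_right h).map (restrictScalarsHom b ι)
  symm
  refine Nat.card_congr (Equiv.ofBijective (fun T => ⟨restrictScalarsHom b ι T.1,
    T.2.1.map _, (hcomm T.1).2 T.2.2⟩) ⟨?_, ?_⟩)
  · intro T U h
    exact Subtype.ext (hinj (congr_arg Subtype.val h))
  · rintro ⟨M, hM, hMc⟩
    obtain ⟨k, hk⟩ := exists_scalar_add_pow_eq θ hN
    obtain ⟨T, rfl⟩ := exists_restrictScalarsHom_eq_of_commute b hθ (M := M) (by
      rw [← hk, map_pow]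
      exact hMc.pow_right k)
    exact ⟨⟨T, (IsNilpotent.map_iff hinj).1 hM, (hcomm T).1 hMc⟩, rfl⟩

end Matrix

end RestrictScalars

/-! ### Generalized Jordan matrices -/

namespace BuildingBlock

open Polynomial Matrix

section

variable {F : Type*} [Field F] {f : F[X]}

/-- The basis `1, θ, …, θ ^ (deg f - 1)` of `F[x] / (f)`, with `θ` the class of `x`. -/
noncomputable def adjoinRootBasis (hf : f ≠ 0) :
    Module.Basis (Fin f.natDegree) F (AdjoinRoot f) :=
  (AdjoinRoot.powerBasis hf).basis

theorem companion_eq_transpose_leftMulMatrix [Fact (Irreducible f)] (hmonic : f.Monic) :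
    companion f =
      (Algebra.leftMulMatrix (adjoinRootBasis hmonic.ne_zero) (AdjoinRoot.root f))ᵀ := by
  have h := (AdjoinRoot.powerBasis hmonic.ne_zero).leftMulMatrix
  have hm : (AdjoinRoot.powerBasis hmonic.ne_zero).minpolyGen = f := by
    rw [PowerBasis.minpolyGen_eq, AdjoinRoot.minpoly_powerBasis_gen_of_monic hmonic]
  rw [hm] at h
  ext i j
  refine Eq.trans ?_ (congr_fun₂ h j i).symm
  exact if_congr Iff.rfl rfl (if_congr eq_comm rfl rfl)

/-- In terms of `K = F[x] / (f)`, the transpose of `J_λ(f)` is `θ + S`, where `θ` is the class of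
`x` and `S` is the shift. -/
theorem transpose_jordanMatrix_submatrix [Fact (Irreducible f)] (hmonic : f.Monic) {n : ℕ}
    (p : n.Partition) :
    (jordanMatrix p f)ᵀ.submatrix (Equiv.sigmaProdDistrib _ _) (Equiv.sigmaProdDistrib _ _) =
      restrictScalarsHom (adjoinRootBasis hmonic.ne_zero)
        (Σ s : Fin (partList p).length, Fin ((partList p).get s))
        (scalar _ (AdjoinRoot.root f) + shift (AdjoinRoot f) fun s => (partList p).get s) := by
  ext ⟨⟨r, a⟩, i⟩ ⟨⟨s, j⟩, k⟩
  refine Eq.trans ?_ (restrictScalarsHom_apply _ _ _ _).symm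
  rw [Matrix.add_apply, map_add]
  change blockDiagonal' (fun s => jordanBlock f ((partList p).get s))
    ⟨s, (j, k)⟩ ⟨r, (a, i)⟩ = _
  by_cases hrs : s = r
  · subst hrs
    rw [blockDiagonal'_apply_eq]
    change (if j = a then companion f else if (j : ℕ) + 1 = a then 1 else 0) k i = _
    by_cases hja : j = a
    · subst hja
      simp [companion_eq_transpose_leftMulMatrix hmonic, shift]
    · have h1 : (⟨s, a⟩ : Σ s : Fin (partList p).length, Fin ((partList p).get s)) ≠ ⟨s, j⟩ :=
        fun h => hja (eq_of_heq (Sigma.mk.inj h).2).symm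
      rw [if_neg hja, scalar_apply, diagonal_apply_ne _ h1, map_zero, zero_add]
      by_cases h2 : (j : ℕ) + 1 = a
      · simp [shift, h2, one_apply, eq_comm]
      · have h3 : ¬ (a : ℕ) = j + 1 := fun h => h2 h.symm
        simp [shift, h2, h3]
  · have h1 : (⟨r, a⟩ : Σ s : Fin (partList p).length, Fin ((partList p).get s)) ≠ ⟨s, j⟩ :=
      fun h => hrs (congr_arg Sigma.fst h).symm
    rw [blockDiagonal'_apply_ne _ _ _ hrs, scalar_apply, diagonal_apply_ne _ h1]
    have h2 : ¬r = s := fun h => hrs h.symm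
    simp [shift, h2]

end

theorem length_partList {n : ℕ} (p : n.Partition) : (partList p).length = length p := by
  rw [partList, Multiset.length_sort, length]

theorem get_partList_mem {n : ℕ} (p : n.Partition) (s : Fin (partList p).length) :
    (partList p).get s ∈ p.parts :=
  (Multiset.mem_sort _).1 (List.get_mem _ _)

theorem conjPart_eq_sum {n : ℕ} (p : n.Partition) (i : ℕ) :
    conjPart p i = ∑ s : Fin (partList p).length, if i ≤ (partList p).get s then 1 else 0 := by
  have hlist (L : List ℕ) : Multiset.card ((L : Multiset ℕ).filter (i ≤ ·)) =
      (L.map fun x => if i ≤ x then 1 else 0).sum := by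
    induction L with
    | nil => rfl
    | cons a L ih =>
      rw [← Multiset.cons_coe, Multiset.filter_cons, Multiset.card_add, ih]
      split_ifs <;> simp_all
  have h : p.parts = (partList p : Multiset ℕ) := (Multiset.sort_eq _ _).symm
  rw [conjPart, h, hlist, ← Fin.sum_univ_fun_getElem]
  rfl

/-- Both sides count the triples `(r, s, i)` with `1 ≤ i ≤ λ_r` and `i ≤ λ_s`. -/
theorem sum_min_eq_inner {n : ℕ} (p : n.Partition) :
    ∑ r, ∑ s, min ((partList p).get r) ((partList p).get s) = inner p p := by
  have hmin (r s : Fin (partList p).length) : min ((partList p).get r) ((partList p).get s) =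
      ∑ i ∈ Finset.Icc 1 n, (if i ≤ (partList p).get r then 1 else 0) *
        (if i ≤ (partList p).get s then 1 else 0) := by
    have h1 := p.le_of_mem_parts (get_partList_mem p r)
    simp only [mul_ite, mul_one, mul_zero, ← ite_and]
    rw [Finset.sum_boole, Nat.cast_id]
    have : (Finset.Icc 1 n).filter (fun i => i ≤ (partList p).get s ∧ i ≤ (partList p).get r) =
        Finset.Icc 1 (min ((partList p).get r) ((partList p).get s)) := by
      ext i
      simp only [Finset.mem_filter, Finset.mem_Icc, le_min_iff]
      omega
    rw [this, Nat.card_Icc, Nat.add_sub_cancel]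
  simp_rw [hmin, inner, conjPart_eq_sum, Finset.sum_mul_sum]
  rw [Finset.sum_congr rfl fun r _ => Finset.sum_comm, Finset.sum_comm]

end BuildingBlock

theorem mainTheorem4 {F : Type*} [Field F] [Fintype F] {n : ℕ} (p : n.Partition)
    (f : Polynomial F) (hmonic : f.Monic) (hirr : Irreducible f) :
    Nat.card {M : Matrix (BuildingBlock.Idx p f) (BuildingBlock.Idx p f) F //
        IsNilpotent M ∧ Commute M (BuildingBlock.jordanMatrix p f)} =
      Fintype.card F ^
        (f.natDegree * (BuildingBlock.inner p p - BuildingBlock.length p)) := by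
  open BuildingBlock in
  have : Fact (Irreducible f) := ⟨hirr⟩
  let pb := AdjoinRoot.powerBasis hmonic.ne_zero
  have : Module.Finite F (AdjoinRoot f) := pb.finite
  have : Finite (AdjoinRoot f) := Module.finite_of_finite F
  have hcardK : Nat.card (AdjoinRoot f) = Fintype.card F ^ f.natDegree := by
    rw [Module.natCard_eq_pow_finrank (K := F), pb.finrank, Nat.card_eq_fintype_card]
    rfl
  let ι := Σ s : Fin (partList p).length, Fin ((partList p).get s)
  let e : ι × Fin f.natDegree ≃ Idx p f := Equiv.sigmaProdDistrib _ _
  -- transposition and regrouping of the indices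
  have h1 : Nat.card {M : Matrix (Idx p f) (Idx p f) F //
        IsNilpotent M ∧ Commute M (jordanMatrix p f)} =
      Nat.card {M : Matrix (ι × Fin f.natDegree) (ι × Fin f.natDegree) F // IsNilpotent M ∧
        Commute M (Matrix.restrictScalarsHom (adjoinRootBasis hmonic.ne_zero) ι
          (Matrix.scalar _ (AdjoinRoot.root f) +
            Matrix.shift (AdjoinRoot f) fun s => (partList p).get s))} := by
    let E : Matrix (Idx p f) (Idx p f) F ≃
        Matrix (ι × Fin f.natDegree) (ι × Fin f.natDegree) F :=
      (Matrix.transposeAddEquiv _ _ F).toEquiv.trans (Matrix.reindex e.symm e.symm)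
    refine Nat.card_congr (E.subtypeEquiv fun M => and_congr ?_ ?_)
    · rw [← Matrix.isNilpotent_transpose_iff]
      exact (IsNilpotent.map_iff (Matrix.reindexAlgEquiv F F e.symm).injective).symm
    · rw [← transpose_jordanMatrix_submatrix hmonic p]
      change _ ↔ Commute (Matrix.reindexAlgEquiv F F e.symm M.transpose)
        (Matrix.reindexAlgEquiv F F e.symm (jordanMatrix p f).transpose)
      rw [commute_iff_eq, commute_iff_eq, ← map_mul, ← map_mul,
        (Matrix.reindexAlgEquiv F F e.symm).injective.eq_iff, ← Matrix.transpose_mul,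
        ← Matrix.transpose_mul, Matrix.transpose_inj, eq_comm]
  have hadj : Algebra.adjoin F {AdjoinRoot.root f} = ⊤ := pb.adjoin_gen_eq_top
  rw [h1, Matrix.natCard_isNilpotent_commute_restrictScalarsHom _ hadj
    Matrix.isNilpotent_shift]
  have h2 := Matrix.natCard_isNilpotent_commute_shift_mul (K := AdjoinRoot f)
    (l := fun s => (partList p).get s) fun s => p.parts_pos (get_partList_mem p s)
  rw [(Fintype.card_fin _).trans (length_partList p), sum_min_eq_inner] at h2
  rw [pow_mul, ← hcardK]
  have hpos : 0 < Nat.card (AdjoinRoot f) := Nat.card_pos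
  refine Nat.eq_of_mul_eq_mul_right (pow_pos hpos (length p)) ?_
  rw [h2, ← pow_add, Nat.sub_add_cancel (length_le_inner p)]
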